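/- Let $k\ge 1$ be an integer, let $\rho>0$, and let $B=B^{k+1}_\rho=\{x\in\mathbb{R}^{k+1}:|x|<\rho\}$ with the metric $\left(\frac{2\rho^2}{\rho^2-|x|^2}\right)^2|dx|^2$ be the ball model of the $(k+1)$-dimensional hyperbolic space of constant sectional curvature $-1/\rho^2$. Let $\triangle$ be its Laplace--Beltrami operator and let $r(x)=\rho\ln\frac{\rho+|x|}{\rho-|x|}$ be the hyperbolic distance from the origin to $x$. Let $\lambda\in\mathbb{R}$. All functions are real-valued. (1) There is exactly one function $\varphi_\lambda:[0,\infty)\to\mathbb{R}$ such that $\varphi_\lambda(0)=1$ and $x\mapsto\varphi_\lambda(r(x))$ is a $C^2$ function on $B$ satisfying $\triangle f+\lambda f=0$ on $B$ (the radial eigenfunction with value $1$ at the origin), and $$\lim_{r\to\infty}\varphi_\lambda(r)=\begin{cases}+\infty,&\lambda<0,\\ 1,&\lambda=0,\\ 0,&\lambda>0.\end{cases}$$ (2) The Dirichlet eigenvalue problem at infinity, that is, the problem of finding a (not necessarily radial) function $f\in C^2(B)$ with $$\triangle f+\lambda f=0\ \text{ on } B,\qquad f(0)=1,\qquad f(x)\to0\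 \text{ as } r(x)\to\infty$$ (the limit being uniform in the direction of $x$), has a solution if and only if $\lambda>0$. -/

import Mathlib

/-!
The hyperbolic metric is conformally flat, so its Laplacian is a positive multiple of the Euclidean
Laplacian plus a radial drift. On a function `h(τ)` of the unit-curvature distance `τ = r / ρ` it
becomes `ρ⁻² (h'' + (n - 1) coth τ h')`, so radial eigenfunctions solve a singular linear ODE on
`(0, ∞)`. In the integrated form `(sinh τ ^ (n - 1) h')' = -Λ sinh τ ^ (n - 1) h` with `Λ = μ ρ²`
the solution with given `h(0)` is unique, and for `Λ < 0` it grows at least like `log (cosh τ)`;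
for `Λ > 0` a perturbed energy of the damped oscillator `h'' + (n - 1) coth τ h' + Λ h = 0` decays
exponentially. In the variable `t = tanh² (τ / 2) = |x|² / ρ²` the same equation is hypergeometric,
and its power series at `t = 0` gives existence together with smoothness at the origin.

For `μ ≤ 0` a solution of the Dirichlet problem at infinity would be subharmonic where it is
positive, so the maximum principle on large balls contradicts the value `1` at the origin.
-/

open Filter Topology

namespace HypBall

/-- The Laplace–Beltrami operator of a Riemannian metric `g` given in one global chart by its
matrix `(g i j)`:
`Δ f = (det g)^(-1/2) ∑ i, ∂_i ((det g)^(1/2) ∑ j, g^{ij} ∂_j f)`. -/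
noncomputable def laplaceBeltrami {n : ℕ}
    (g : EuclideanSpace ℝ (Fin n) → Matrix (Fin n) (Fin n) ℝ)
    (f : EuclideanSpace ℝ (Fin n) → ℝ) (x : EuclideanSpace ℝ (Fin n)) : ℝ :=
  (Real.sqrt (g x).det)⁻¹ *
    ∑ i, fderiv ℝ (fun y => Real.sqrt (g y).det *
      ∑ j, (g y)⁻¹ i j * fderiv ℝ f y (EuclideanSpace.single j 1)) x
        (EuclideanSpace.single i 1)

/-- The metric `(2ρ² / (ρ² - |x|²))² |dx|²` of the ball model of hyperbolic `n`-space with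
constant sectional curvature `-1/ρ²`. The model is the open Euclidean ball `|x| < ρ`. -/
noncomputable def ballMetric (n : ℕ) (ρ : ℝ) (x : EuclideanSpace ℝ (Fin n)) :
    Matrix (Fin n) (Fin n) ℝ :=
  (2 * ρ ^ 2 / (ρ ^ 2 - ‖x‖ ^ 2)) ^ 2 • (1 : Matrix (Fin n) (Fin n) ℝ)

/-- The hyperbolic distance from the origin to a point `x` of the ball model (`|x| < ρ`). -/
noncomputable def hypRadius {n : ℕ} (ρ : ℝ) (x : EuclideanSpace ℝ (Fin n)) : ℝ :=
  ρ * Real.log ((ρ + ‖x‖) / (ρ - ‖x‖))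

/-- `f` is a `C²` solution of `Δ f + μ f = 0` on the whole ball model, where `Δ` is the
hyperbolic Laplacian. -/
def SolvesEigenEquation (n : ℕ) (ρ μ : ℝ) (f : EuclideanSpace ℝ (Fin n) → ℝ) : Prop :=
  ContDiffOn ℝ 2 f (Metric.ball 0 ρ) ∧
    ∀ x ∈ Metric.ball (0 : EuclideanSpace ℝ (Fin n)) ρ,
      laplaceBeltrami (ballMetric n ρ) f x + μ * f x = 0

/-- `φ`, as a function of the hyperbolic distance `r ≥ 0` to the origin, is a radial eigenfunction
of the hyperbolic Laplacian with eigenvalue `μ` and takes the value `1` at the origin. -/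
def IsNormalizedRadialEigenfunction (n : ℕ) (ρ μ : ℝ) (φ : ℝ → ℝ) : Prop :=
  SolvesEigenEquation n ρ μ (fun x => φ (hypRadius ρ x)) ∧ φ 0 = 1

/-- `f` solves the Dirichlet eigenvalue problem at infinity with value `1` at the origin:
`Δ f + μ f = 0` on hyperbolic space, `f = 1` at the origin, and `f x → 0` as the hyperbolic
distance from `x` to the origin tends to infinity. -/
def SolvesDirichletAtInfinity (n : ℕ) (ρ μ : ℝ) (f : EuclideanSpace ℝ (Fin n) → ℝ) : Prop :=
  SolvesEigenEquation n ρ μ f ∧ f 0 = 1 ∧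
    Tendsto f (comap (hypRadius ρ) atTop ⊓ 𝓟 (Metric.ball 0 ρ)) (𝓝 0)

end HypBall

namespace HypBall

section Monotonicity

variable {f f' : ℝ → ℝ} {a b c t : ℝ}

theorem le_of_tendsto_nhdsGT_of_hasDerivAt_nonneg
    (hf : ∀ s ∈ Set.Ioi a, HasDerivAt f (f' s) s) (hf' : ∀ s ∈ Set.Ioi a, 0 ≤ f' s)
    (hlim : Tendsto f (𝓝[>] a) (𝓝 c)) (ht : a < t) : c ≤ f t := by
  have hmono : MonotoneOn f (Set.Ioi a) :=
    monotoneOn_of_hasDerivWithinAt_nonneg (convex_Ioi a)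
      (fun s hs => (hf s hs).continuousAt.continuousWithinAt)
      (fun s hs => (hf s (interior_subset hs)).hasDerivWithinAt)
      (fun s hs => hf' s (interior_subset hs))
  refine le_of_tendsto hlim ?_
  filter_upwards [Ioo_mem_nhdsGT ht] with s hs
  exact hmono hs.1 ht hs.2.le

theorem le_mul_exp_of_hasDerivAt_le {κ : ℝ}
    (hf : ∀ s ∈ Set.Ioi a, HasDerivAt f (f' s) s) (hf' : ∀ s ∈ Set.Ioi a, f' s ≤ κ * f s)
    (hlim : Tendsto f (𝓝[>] a) (𝓝 c)) (ht : a < t) : f t ≤ c * Real.exp (κ * (t - a)) := by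
  have hexp : ∀ s, HasDerivAt (fun s => Real.exp (-κ * (s - a)))
      (Real.exp (-κ * (s - a)) * (-κ)) s := fun s => by
    simpa using (((hasDerivAt_id s).sub_const a).const_mul (-κ)).exp
  have hlim' : Tendsto (fun s => -(f s * Real.exp (-κ * (s - a)))) (𝓝[>] a) (𝓝 (-c)) := by
    simpa using (hlim.mul ((hexp a).continuousAt.tendsto.mono_left nhdsWithin_le_nhds)).neg
  have hle := le_of_tendsto_nhdsGT_of_hasDerivAt_nonneg (fun s hs => ((hf s hs).mul (hexp s)).neg)
    (fun s hs => by
      nlinarith [mul_nonneg (sub_nonneg.2 (hf' s hs)) (Real.exp_pos (-κ * (s - a))).le]) hlim' ht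
  have hle' : f t * Real.exp (-κ * (t - a)) ≤ c := by simpa using hle
  rwa [neg_mul, Real.exp_neg, ← div_eq_mul_inv, div_le_iff₀ (Real.exp_pos _)] at hle'

end Monotonicity

section RadialEquation

/-- `h` solves the eigenvalue equation `h'' + a coth h' + Λ h = 0` for radial functions on the
hyperbolic space of dimension `a + 1` and curvature `-1`, as a function of the distance `τ > 0` to
the origin, and is regular at the origin with value `c`. The derivative `q` of `h` is carried along,
so that the equation is a first-order system. -/
structure IsRadialSolution (a Λ c : ℝ) (h q : ℝ → ℝ) : Prop where
  hasDerivAt : ∀ τ ∈ Set.Ioi 0, HasDerivAt h (q τ) τ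
  hasDerivAt_velocity : ∀ τ ∈ Set.Ioi 0,
    HasDerivAt q (-(a * (Real.cosh τ / Real.sinh τ) * q τ) - Λ * h τ) τ
  tendsto : Tendsto h (𝓝[>] 0) (𝓝 c)
  tendsto_velocity : Tendsto q (𝓝[>] 0) (𝓝 0)

variable {a Λ c c₁ c₂ τ : ℝ} {h q h₁ q₁ h₂ q₂ : ℝ → ℝ}

theorem one_le_cosh_div_sinh (hτ : 0 < τ) : 1 ≤ Real.cosh τ / Real.sinh τ :=
  (one_le_div (Real.sinh_pos_iff.2 hτ)).2 (Real.sinh_lt_cosh τ).le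

theorem cosh_div_sinh_le_two (hτ : 1 ≤ τ) : Real.cosh τ / Real.sinh τ ≤ 2 := by
  rw [div_le_iff₀ (Real.sinh_pos_iff.2 (by linarith)), Real.cosh_eq, Real.sinh_eq]
  have hexp : Real.exp (2 * τ) * Real.exp (-τ) = Real.exp τ := by
    rw [← Real.exp_add]; ring_nf
  nlinarith [Real.add_one_le_exp (2 * τ), Real.exp_pos (-τ)]

theorem hasDerivAt_sinh_rpow (a : ℝ) (hτ : 0 < τ) :
    HasDerivAt (fun s => Real.sinh s ^ a)
      (a * (Real.cosh τ / Real.sinh τ) * Real.sinh τ ^ a) τ := by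
  have hsinh : 0 < Real.sinh τ := Real.sinh_pos_iff.2 hτ
  convert (Real.hasDerivAt_sinh τ).rpow_const (p := a) (Or.inl hsinh.ne') using 1
  rw [Real.rpow_sub_one hsinh.ne']
  ring

theorem tendsto_sinh_rpow_nhdsGT_zero (ha : 0 ≤ a) :
    Tendsto (fun s => Real.sinh s ^ a) (𝓝[>] 0) (𝓝 (0 ^ a)) := by
  have hcont : ContinuousAt (fun s => Real.sinh s ^ a) 0 :=
    Real.continuous_sinh.continuousAt.rpow_const (Or.inr ha)
  simpa using hcont.tendsto.mono_left nhdsWithin_le_nhds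

theorem hasDerivAt_tanh (τ : ℝ) : HasDerivAt Real.tanh (1 - Real.tanh τ ^ 2) τ := by
  have hcosh := (Real.cosh_pos τ).ne'
  have hquot := (Real.hasDerivAt_sinh τ).div (Real.hasDerivAt_cosh τ) hcosh
  rw [funext Real.tanh_eq_sinh_div_cosh]
  refine hquot.congr_deriv ?_
  field_simp

namespace IsRadialSolution

theorem sub (h₁_sol : IsRadialSolution a Λ c₁ h₁ q₁) (h₂_sol : IsRadialSolution a Λ c₂ h₂ q₂) :
    IsRadialSolution a Λ (c₁ - c₂) (h₁ - h₂) (q₁ - q₂) where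
  hasDerivAt s hs := (h₁_sol.hasDerivAt s hs).sub (h₂_sol.hasDerivAt s hs)
  hasDerivAt_velocity s hs := by
    refine ((h₁_sol.hasDerivAt_velocity s hs).sub (h₂_sol.hasDerivAt_velocity s hs)).congr_deriv ?_
    simp only [Pi.sub_apply]
    ring
  tendsto := h₁_sol.tendsto.sub h₂_sol.tendsto
  tendsto_velocity := by
    simpa [Pi.sub_def] using h₁_sol.tendsto_velocity.sub h₂_sol.tendsto_velocity

theorem eq_zero (ha : 0 ≤ a) (hsol : IsRadialSolution a Λ 0 h q) (hτ : 0 < τ) : h τ = 0 := by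
  have hlim : Tendsto (fun s => q s ^ 2 + h s ^ 2) (𝓝[>] 0) (𝓝 0) := by
    simpa using (hsol.tendsto_velocity.pow 2).add (hsol.tendsto.pow 2)
  have henergy : q τ ^ 2 + h τ ^ 2 ≤ 0 * Real.exp (|1 - Λ| * (τ - 0)) := by
    refine le_mul_exp_of_hasDerivAt_le (f := fun s => q s ^ 2 + h s ^ 2)
      (fun s hs => ((hsol.hasDerivAt_velocity s hs).pow 2).add ((hsol.hasDerivAt s hs).pow 2))
      (fun s hs => ?_) hlim hτ
    have hdamping : 0 ≤ a * (Real.cosh s / Real.sinh s) * q s ^ 2 :=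
      mul_nonneg (mul_nonneg ha (zero_le_one.trans (one_le_cosh_div_sinh hs))) (sq_nonneg _)
    have hcoupling : 2 * (1 - Λ) * (h s * q s) ≤ |1 - Λ| * (q s ^ 2 + h s ^ 2) := by
      rcases abs_cases (1 - Λ) with ⟨habs, hsign⟩ | ⟨habs, hsign⟩ <;> rw [habs] <;>
        nlinarith [sq_nonneg (h s - q s), sq_nonneg (h s + q s)]
    simp only [Nat.cast_ofNat, Nat.add_one_sub_one, pow_one]
    linarith
  nlinarith [sq_nonneg (q τ), sq_nonneg (h τ)]

theorem eqOn (ha : 0 ≤ a) (h₁_sol : IsRadialSolution a Λ c h₁ q₁)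
    (h₂_sol : IsRadialSolution a Λ c h₂ q₂) : Set.EqOn h₁ h₂ (Set.Ioi 0) := fun s hs => by
  have hdiff : IsRadialSolution a Λ 0 (h₁ - h₂) (q₁ - q₂) := by simpa using h₁_sol.sub h₂_sol
  have hzero : (h₁ - h₂) s = 0 := hdiff.eq_zero ha hs
  exact sub_eq_zero.1 hzero

section Growth

theorem mul_velocity_nonneg (ha : 0 ≤ a) (hΛ : Λ ≤ 0) (hsol : IsRadialSolution a Λ c h q)
    (hτ : 0 < τ) : 0 ≤ h τ * q τ := by
  have hlim : Tendsto (fun s => Real.sinh s ^ a * (h s * q s)) (𝓝[>] 0) (𝓝 0) := by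
    simpa using (tendsto_sinh_rpow_nhdsGT_zero ha).mul (hsol.tendsto.mul hsol.tendsto_velocity)
  have hflux : 0 ≤ Real.sinh τ ^ a * (h τ * q τ) := by
    refine le_of_tendsto_nhdsGT_of_hasDerivAt_nonneg
      (f := fun s => Real.sinh s ^ a * (h s * q s))
      (f' := fun s => Real.sinh s ^ a * (q s ^ 2 - Λ * h s ^ 2)) (fun s hs => ?_) (fun s hs => ?_)
      hlim hτ
    · refine ((hasDerivAt_sinh_rpow a hs).mul
        ((hsol.hasDerivAt s hs).mul (hsol.hasDerivAt_velocity s hs))).congr_deriv ?_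
      simp only [Pi.mul_apply]
      ring
    · have := Real.rpow_pos_of_pos (Real.sinh_pos_iff.2 hs) a
      have := mul_nonneg (neg_nonneg.2 hΛ) (sq_nonneg (h s))
      exact mul_nonneg (by positivity) (by nlinarith)
  exact nonneg_of_mul_nonneg_right hflux (Real.rpow_pos_of_pos (Real.sinh_pos_iff.2 hτ) a)

theorem sq_le_sq (ha : 0 ≤ a) (hΛ : Λ ≤ 0) (hsol : IsRadialSolution a Λ c h q) (hτ : 0 < τ) :
    c ^ 2 ≤ h τ ^ 2 :=
  le_of_tendsto_nhdsGT_of_hasDerivAt_nonneg (f := h ^ 2) (fun s hs => (hsol.hasDerivAt s hs).pow 2)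
    (fun s hs => by simpa [mul_assoc] using hsol.mul_velocity_nonneg ha hΛ hs)
    (hsol.tendsto.pow 2) hτ

theorem le (ha : 0 ≤ a) (hΛ : Λ ≤ 0) (hc : 0 < c) (hsol : IsRadialSolution a Λ c h q)
    (hτ : 0 < τ) : c ≤ h τ := by
  refine (pow_le_pow_iff_left₀ hc.le (le_of_not_gt fun hneg => ?_) two_ne_zero).1
    (hsol.sq_le_sq ha hΛ hτ)
  obtain ⟨s, hspos, hs⟩ :=
    ((hsol.tendsto.eventually_const_lt hc).and (Ioo_mem_nhdsGT hτ)).exists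
  have hcont : ContinuousOn h (Set.Icc s τ) := fun r hr =>
    (hsol.hasDerivAt r (hs.1.trans_le hr.1)).continuousAt.continuousWithinAt
  obtain ⟨r, hr, hzero⟩ := intermediate_value_Icc' hs.2.le hcont ⟨hneg.le, hspos.le⟩
  nlinarith [hsol.sq_le_sq ha hΛ (hs.1.trans_le hr.1)]

theorem mul_tanh_le_velocity (ha : 0 ≤ a) (hΛ : Λ ≤ 0) (hc : 0 < c)
    (hsol : IsRadialSolution a Λ c h q) (hτ : 0 < τ) :
    -Λ * c / (a + 1) * Real.tanh τ ≤ q τ := by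
  set δ := -Λ * c / (a + 1)
  have hδ0 : 0 ≤ δ := div_nonneg (mul_nonneg (neg_nonneg.2 hΛ) hc.le) (by linarith)
  have hδ1 : δ * (a + 1) = -Λ * c := div_mul_cancel₀ _ (by linarith)
  have hlim : Tendsto (fun s => Real.sinh s ^ a * (q s - δ * Real.tanh s)) (𝓝[>] 0) (𝓝 0) := by
    have htanh := (hasDerivAt_tanh 0).continuousAt.tendsto.mono_left
      (nhdsWithin_le_nhds (s := Set.Ioi 0))
    simpa using (tendsto_sinh_rpow_nhdsGT_zero ha).mul
      (hsol.tendsto_velocity.sub (htanh.const_mul δ))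
  have hflux : 0 ≤ Real.sinh τ ^ a * (q τ - δ * Real.tanh τ) := by
    refine le_of_tendsto_nhdsGT_of_hasDerivAt_nonneg
      (f := fun s => Real.sinh s ^ a * (q s - δ * Real.tanh s))
      (f' := fun s => Real.sinh s ^ a * (-Λ * h s - δ * (a + 1 - Real.tanh s ^ 2)))
      (fun s hs => ?_) (fun s hs => ?_) hlim hτ
    · refine ((hasDerivAt_sinh_rpow a hs).mul ((hsol.hasDerivAt_velocity s hs).sub
        ((hasDerivAt_tanh s).const_mul δ))).congr_deriv ?_
      have hsinh := (Real.sinh_pos_iff.2 hs).ne'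
      have hcosh := (Real.cosh_pos s).ne'
      simp only [Pi.sub_apply, Real.tanh_eq_sinh_div_cosh]
      field_simp
      ring
    · have hh := mul_le_mul_of_nonneg_left (hsol.le ha hΛ hc hs) (neg_nonneg.2 hΛ)
      exact mul_nonneg (Real.rpow_nonneg (Real.sinh_pos_iff.2 hs).le a)
        (by nlinarith [mul_nonneg hδ0 (sq_nonneg (Real.tanh s))])
  exact sub_nonneg.1
    (nonneg_of_mul_nonneg_right hflux (Real.rpow_pos_of_pos (Real.sinh_pos_iff.2 hτ) a))

theorem add_log_cosh_le (ha : 0 ≤ a) (hΛ : Λ ≤ 0) (hc : 0 < c)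
    (hsol : IsRadialSolution a Λ c h q) (hτ : 0 < τ) :
    c + -Λ * c / (a + 1) * Real.log (Real.cosh τ) ≤ h τ := by
  set δ := -Λ * c / (a + 1)
  have hlog : ∀ s, HasDerivAt (fun s => Real.log (Real.cosh s)) (Real.tanh s) s := fun s => by
    simpa [Real.tanh_eq_sinh_div_cosh] using (Real.hasDerivAt_cosh s).log (Real.cosh_pos s).ne'
  have hlim : Tendsto (fun s => h s - δ * Real.log (Real.cosh s)) (𝓝[>] 0) (𝓝 c) := by
    simpa using hsol.tendsto.sub
      (((hlog 0).continuousAt.tendsto.mono_left nhdsWithin_le_nhds).const_mul δ)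
  have hle := le_of_tendsto_nhdsGT_of_hasDerivAt_nonneg
    (fun s hs => (hsol.hasDerivAt s hs).sub ((hlog s).const_mul δ))
    (fun s hs => sub_nonneg.2 (hsol.mul_tanh_le_velocity ha hΛ hc hs)) hlim hτ
  exact le_sub_iff_add_le.1 hle

theorem tendsto_atTop (ha : 0 ≤ a) (hΛ : Λ < 0) (hc : 0 < c)
    (hsol : IsRadialSolution a Λ c h q) : Tendsto h atTop atTop := by
  have hδ : 0 < -Λ * c / (a + 1) := div_pos (mul_pos (neg_pos.2 hΛ) hc) (by linarith)
  have hlog : Tendsto (fun s => Real.log (Real.cosh s)) atTop atTop :=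
    Real.tendsto_log_atTop.comp
      (tendsto_atTop_mono (fun s => (Real.sinh_lt_cosh s).le) Real.sinhOrderIso.tendsto_atTop)
  refine tendsto_atTop_mono' _ ?_ (tendsto_atTop_add_const_left _ c (hlog.const_mul_atTop hδ))
  filter_upwards [eventually_gt_atTop 0] with s hs
  exact hsol.add_log_cosh_le ha hΛ.le hc hs

end Growth

section Decay

/-- The Lyapunov function `q² + Λ h² + 2 ε h q` of the damped oscillator
`h'' + a coth h' + Λ h = 0`: the cross term makes it dissipate in `h` as well as in `q`. -/
def lyapunov (Λ ε : ℝ) (h q : ℝ → ℝ) (τ : ℝ) : ℝ :=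
  q τ ^ 2 + Λ * h τ ^ 2 + 2 * ε * (h τ * q τ)

theorem hasDerivAt_lyapunov (hsol : IsRadialSolution a Λ c h q) (ε : ℝ) (hτ : 0 < τ) :
    HasDerivAt (lyapunov Λ ε h q) (-2 * a * (Real.cosh τ / Real.sinh τ) * q τ ^ 2 +
      2 * ε * (q τ ^ 2 - a * (Real.cosh τ / Real.sinh τ) * (h τ * q τ) - Λ * h τ ^ 2)) τ := by
  have hh := hsol.hasDerivAt τ hτ
  have hq := hsol.hasDerivAt_velocity τ hτ
  refine (((hq.pow 2).add ((hh.pow 2).const_mul Λ)).add ((hh.mul hq).const_mul (2 * ε))).congr_deriv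
    ?_
  simp only [Nat.cast_ofNat, Nat.add_one_sub_one, pow_one]
  ring

theorem mul_sq_le_lyapunov {ε : ℝ} (hε : 2 * ε ^ 2 ≤ Λ) (h q : ℝ → ℝ) (τ : ℝ) :
    Λ * h τ ^ 2 ≤ 2 * lyapunov Λ ε h q τ := by
  unfold lyapunov
  nlinarith [sq_nonneg (q τ + ε * h τ), sq_nonneg (q τ + 2 * ε * h τ),
    mul_nonneg (sub_nonneg.2 hε) (sq_nonneg (h τ)), sq_nonneg (q τ)]

theorem lyapunov_le {ε : ℝ} (hε : ε ^ 2 ≤ Λ) (h q : ℝ → ℝ) (τ : ℝ) :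
    lyapunov Λ ε h q τ ≤ 2 * (q τ ^ 2 + Λ * h τ ^ 2) := by
  unfold lyapunov
  nlinarith [sq_nonneg (q τ - ε * h τ), mul_nonneg (sub_nonneg.2 hε) (sq_nonneg (h τ))]

theorem lyapunov_dissipation_le {ε C H Q : ℝ} (ha : 0 ≤ a) (hΛ : 0 < Λ) (hε : 0 ≤ ε)
    (hrate : ε * (2 * Λ + 4 * a ^ 2) ≤ a * Λ) (hC : C ∈ Set.Icc 1 2) :
    -2 * a * C * Q ^ 2 + 2 * ε * (Q ^ 2 - a * C * (H * Q) - Λ * H ^ 2) ≤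
      -(a * Q ^ 2 + ε * (Λ * H ^ 2)) := by
  refine le_of_mul_le_mul_left ?_ hΛ
  have hcross := mul_nonneg hε (sq_nonneg (Λ * H + a * C * Q))
  have hC_sq : ε * (a ^ 2 * C ^ 2) * Q ^ 2 ≤ ε * (4 * a ^ 2) * Q ^ 2 := by
    have : C ^ 2 ≤ 4 := by nlinarith [hC.1, hC.2]
    gcongr ε * ?_ * Q ^ 2
    nlinarith [sq_nonneg a]
  have hC_one : a * Λ * Q ^ 2 ≤ a * Λ * C * Q ^ 2 := by
    nlinarith [mul_nonneg (mul_nonneg (mul_nonneg ha hΛ.le) (sq_nonneg Q)) (sub_nonneg.2 hC.1)]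
  nlinarith [mul_le_mul_of_nonneg_right hrate (sq_nonneg Q)]

theorem exists_sq_le_mul_exp (ha : 0 < a) (hΛ : 0 < Λ) (hsol : IsRadialSolution a Λ c h q) :
    ∃ K κ, 0 < κ ∧ ∀ s ∈ Set.Ioi 1, h s ^ 2 ≤ K * Real.exp (-κ * (s - 1)) := by
  obtain ⟨ε, hε, hrate⟩ : ∃ ε, 0 < ε ∧ ε * (2 * Λ + 4 * a ^ 2) = a * Λ :=
    ⟨a * Λ / (2 * Λ + 4 * a ^ 2), by positivity, div_mul_cancel₀ _ (by positivity)⟩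
  have hε_a : 2 * ε ≤ a := by nlinarith [mul_pos hε (pow_pos ha 2)]
  have hε_Λ : 4 * (ε * a) ≤ Λ := by nlinarith [mul_pos hε hΛ]
  have hε_sq : 2 * ε ^ 2 ≤ Λ := by nlinarith
  set L := lyapunov Λ ε h q
  have hL' := fun s (hs : s ∈ Set.Ioi (1 : ℝ)) =>
    hsol.hasDerivAt_lyapunov ε (zero_lt_one.trans hs)
  have hL_one : Tendsto L (𝓝[>] 1) (𝓝 (L 1)) :=
    (hsol.hasDerivAt_lyapunov ε zero_lt_one).continuousAt.tendsto.mono_left nhdsWithin_le_nhds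
  have hdecay : ∀ s ∈ Set.Ioi (1 : ℝ), L s ≤ L 1 * Real.exp (-(ε / 2) * (s - 1)) := fun s hs =>
    le_mul_exp_of_hasDerivAt_le hL' (fun r hr => by
      have hdiss := lyapunov_dissipation_le (H := h r) (Q := q r) ha.le hΛ hε.le hrate.le
        ⟨one_le_cosh_div_sinh (zero_lt_one.trans hr), cosh_div_sinh_le_two hr.le⟩
      have hL_le := lyapunov_le (by nlinarith : ε ^ 2 ≤ Λ) h q r
      nlinarith [sq_nonneg (q r), sq_nonneg (h r)]) hL_one hs
  refine ⟨2 * L 1 / Λ, ε / 2, half_pos hε, fun s hs => ?_⟩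
  rw [div_mul_eq_mul_div, le_div_iff₀' hΛ]
  linarith [mul_sq_le_lyapunov hε_sq h q s, hdecay s hs]

theorem tendsto_zero (ha : 0 < a) (hΛ : 0 < Λ) (hsol : IsRadialSolution a Λ c h q) :
    Tendsto h atTop (𝓝 0) := by
  obtain ⟨K, κ, hκ, hbound⟩ := hsol.exists_sq_le_mul_exp ha hΛ
  have hlin : Tendsto (fun s : ℝ => -κ * (s - 1)) atTop atBot :=
    (tendsto_atTop_add_const_right _ (-1) tendsto_id).const_mul_atTop_of_neg (neg_neg_of_pos hκ)
  have hexp : Tendsto (fun s => K * Real.exp (-κ * (s - 1))) atTop (𝓝 0) := by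
    simpa using (Real.tendsto_exp_atBot.comp hlin).const_mul K
  have hsq : Tendsto (fun s => h s ^ 2) atTop (𝓝 0) :=
    squeeze_zero' (Eventually.of_forall fun s => sq_nonneg (h s))
      ((eventually_gt_atTop 1).mono hbound) hexp
  refine (tendsto_zero_iff_abs_tendsto_zero h).2 ?_
  simpa [Real.sqrt_sq_eq_abs, Function.comp_def] using hsq.sqrt

end Decay
end IsRadialSolution
end RadialEquation

section PowerSeries

theorem summable_mul_pow_of_le_mul {S : ℕ → ℝ} {C r : ℝ} (hS : ∀ m, 0 ≤ S m)
    (hratio : ∀ m : ℕ, S (m + 1) ≤ (1 + C / (m + 1)) * S m) (hr0 : 0 ≤ r) (hr1 : r < 1) :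
    Summable fun m => S m * r ^ m := by
  obtain ⟨r', hr', hr'1⟩ := exists_between hr1
  have hlim : Tendsto (fun m : ℕ => (1 + C / ((m : ℝ) + 1)) * r) atTop (𝓝 r) := by
    simpa [div_eq_mul_one_div C] using
      ((tendsto_one_div_add_atTop_nhds_zero_nat (𝕜 := ℝ)).const_mul C).const_add 1 |>.mul_const r
  refine summable_of_ratio_norm_eventually_le hr'1 ?_
  filter_upwards [hlim.eventually_le_const hr'] with m hm
  rw [Real.norm_of_nonneg (mul_nonneg (hS _) (pow_nonneg hr0 _)),
    Real.norm_of_nonneg (mul_nonneg (hS _) (pow_nonneg hr0 _)), pow_succ]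
  calc S (m + 1) * (r ^ m * r) ≤ (1 + C / (m + 1)) * S m * (r ^ m * r) := by
        gcongr; exact hratio m
    _ = (1 + C / (m + 1)) * r * (S m * r ^ m) := by ring
    _ ≤ r' * (S m * r ^ m) := by
        gcongr; exact mul_nonneg (hS m) (pow_nonneg hr0 m)

variable {c : ℕ → ℝ} {f : ℝ → ℝ} {t : ℝ}

open FormalMultilinearSeries in
theorem hasFPowerSeriesOnBall_ofScalarsSum
    (hc : ∀ r ∈ Set.Ico (0 : ℝ) 1, Summable fun m => |c m| * r ^ m) :
    HasFPowerSeriesOnBall (ofScalarsSum c) (ofScalars ℝ c) 0 1 := by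
  have hradius : 1 ≤ (ofScalars ℝ c).radius := by
    refine ENNReal.le_of_forall_nnreal_lt fun r hr => le_radius_of_summable_norm _ ?_
    simpa [ofScalars_norm] using hc r ⟨r.2, by exact_mod_cast hr⟩
  exact ((ofScalars ℝ c).hasFPowerSeriesOnBall (one_pos.trans_le hradius)).mono one_pos hradius

theorem hasSum_mul_pow
    (hf : HasFPowerSeriesOnBall f (FormalMultilinearSeries.ofScalars ℝ c) 0 1) (ht : |t| < 1) :
    HasSum (fun m => c m * t ^ m) (f t) := by
  simpa [FormalMultilinearSeries.ofScalars_apply_eq, mul_comm] using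
    hf.hasSum (y := t) (by simpa [enorm_eq_nnnorm, ← NNReal.coe_lt_coe] using ht)

theorem hasSum_natCast_mul_mul_pow
    (hf : HasFPowerSeriesOnBall f (FormalMultilinearSeries.ofScalars ℝ c) 0 1) (ht : |t| < 1) :
    HasSum (fun m : ℕ => m * c m * t ^ m) (t * deriv f t) := by
  have hderiv := (hf.fderiv.hasSum (y := t)
    (by simpa [enorm_eq_nnnorm, ← NNReal.coe_lt_coe] using ht)).mapL
    (ContinuousLinearMap.apply ℝ ℝ t)
  rw [← hasSum_nat_add_iff' 1]
  convert hderiv using 1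
  · ext m
    rw [ContinuousLinearMap.apply_apply, FormalMultilinearSeries.derivSeries_apply_diag,
      FormalMultilinearSeries.ofScalars_apply_eq, smul_eq_mul, nsmul_eq_mul]
    push_cast
    ring
  · simp

theorem differentiableAt_of_hasFPowerSeriesOnBall
    {P : FormalMultilinearSeries ℝ ℝ ℝ} (hf : HasFPowerSeriesOnBall f P 0 1) (ht : |t| < 1) :
    DifferentiableAt ℝ f t :=
  (hf.analyticAt_of_mem (by simpa [enorm_eq_nnnorm, ← NNReal.coe_lt_coe] using ht)).differentiableAt

theorem eq_mul_of_hasSum_of_succ {d : ℕ → ℝ} {A B : ℝ} (hzero : c 0 = 0)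
    (hsucc : ∀ m, c (m + 1) = d m) (hA : HasSum (fun m => c m * t ^ m) A)
    (hB : HasSum (fun m => d m * t ^ m) B) : A = t * B := by
  rw [← hasSum_nat_add_iff' 1] at hA
  have hshift : HasSum (fun m => c (m + 1) * t ^ (m + 1)) (t * B) := by
    simpa only [hsucc, pow_succ', mul_left_comm] using hB.mul_left t
  simpa [hzero] using hA.unique hshift

end PowerSeries

section Existence

/-- The Taylor coefficients `(aₘ, bₘ)` at `t = 0` of the solution `(h, p)` with `h 0 = 1` of
`(1 - t) h' = p`, `t (1 - t) p' + (ν + (ν - 1) t) p + Λ h = 0`. With `t = tanh² (τ / 2)` and `ν`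
half the dimension this is the equation for a radial eigenfunction, in a coordinate in which it has
a regular singular point at the origin. -/
noncomputable def radialCoeff (ν Λ : ℝ) : ℕ → ℝ × ℝ
  | 0 => (1, -Λ / ν)
  | m + 1 =>
    let a := (m * (radialCoeff ν Λ m).1 + (radialCoeff ν Λ m).2) / (m + 1)
    (a, ((m + 1 - ν) * (radialCoeff ν Λ m).2 - Λ * a) / (m + 1 + ν))

/-- The solution `h` of the radial eigenvalue equation with `h 0 = 1`, as a function of
`t = tanh² (τ / 2)`. -/
noncomputable def radialProfile (ν Λ : ℝ) : ℝ → ℝ :=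
  FormalMultilinearSeries.ofScalarsSum fun m => (radialCoeff ν Λ m).1

/-- The companion `p = (1 - t) h'` of `radialProfile`. -/
noncomputable def radialMomentum (ν Λ : ℝ) : ℝ → ℝ :=
  FormalMultilinearSeries.ofScalarsSum fun m => (radialCoeff ν Λ m).2

variable {ν Λ t : ℝ}

theorem add_one_mul_radialCoeff_fst_succ (ν Λ : ℝ) (m : ℕ) :
    (m + 1) * (radialCoeff ν Λ (m + 1)).1 =
      m * (radialCoeff ν Λ m).1 + (radialCoeff ν Λ m).2 :=
  mul_div_cancel₀ _ (by positivity)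

theorem add_one_add_mul_radialCoeff_snd_succ (hν : 0 < ν) (Λ : ℝ) (m : ℕ) :
    (m + 1 + ν) * (radialCoeff ν Λ (m + 1)).2 =
      (m + 1 - ν) * (radialCoeff ν Λ m).2 - Λ * (radialCoeff ν Λ (m + 1)).1 :=
  mul_div_cancel₀ _ (by positivity)

theorem abs_radialCoeff_succ_le (hν : 0 < ν) (Λ : ℝ) (m : ℕ) :
    |(radialCoeff ν Λ (m + 1)).1| + |(radialCoeff ν Λ (m + 1)).2| ≤
      (1 + (1 + |Λ|) / (m + 1)) * (|(radialCoeff ν Λ m).1| + |(radialCoeff ν Λ m).2|) := by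
  have hfst := add_one_mul_radialCoeff_fst_succ ν Λ m
  have hsnd := add_one_add_mul_radialCoeff_snd_succ hν Λ m
  set a := (radialCoeff ν Λ m).1
  set b := (radialCoeff ν Λ m).2
  set a' := (radialCoeff ν Λ (m + 1)).1
  set b' := (radialCoeff ν Λ (m + 1)).2
  have hm : (0 : ℝ) < m + 1 := by positivity
  have ha' : (m + 1) * |a'| ≤ m * |a| + |b| := by
    calc (m + 1) * |a'| = |m * a + b| := by rw [← hfst, abs_mul, abs_of_pos hm]
      _ ≤ m * |a| + |b| := by simpa [abs_mul] using abs_add_le (m * a) b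
  have hb' : (m + 1 + ν) * |b'| ≤ (m + 1 + ν) * |b| + |Λ| * |a'| := by
    have hcoeff : |(m : ℝ) + 1 - ν| ≤ m + 1 + ν := abs_le.2 ⟨by linarith, by linarith⟩
    calc (m + 1 + ν) * |b'| = |(m + 1 - ν) * b - Λ * a'| := by
          rw [← hsnd, abs_mul, abs_of_pos (add_pos hm hν)]
      _ ≤ |(m : ℝ) + 1 - ν| * |b| + |Λ| * |a'| := by
          simpa only [abs_mul] using abs_sub ((m + 1 - ν) * b) (Λ * a')
      _ ≤ _ := by gcongr
  have ha'_le : |a'| ≤ |a| + |b| := by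
    nlinarith [abs_nonneg a, abs_nonneg b, mul_nonneg m.cast_nonneg (abs_nonneg b)]
  have hb'_le : (m + 1) * |b'| ≤ (m + 1) * |b| + |Λ| * (|a| + |b|) := by
    have hΛ := mul_le_mul_of_nonneg_left ha'_le (abs_nonneg Λ)
    rcases le_total |b'| |b| with hle | hle
    · have := mul_le_mul_of_nonneg_left hle hm.le
      nlinarith [mul_nonneg (abs_nonneg Λ) (abs_nonneg a')]
    · nlinarith [mul_le_mul_of_nonneg_left hle hν.le]
  rw [one_add_div hm.ne', div_mul_eq_mul_div, le_div_iff₀' hm]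
  nlinarith [abs_nonneg a]

theorem summable_abs_radialCoeff_mul_pow (hν : 0 < ν) (Λ : ℝ) {r : ℝ}
    (hr : r ∈ Set.Ico (0 : ℝ) 1) :
    Summable fun m => (|(radialCoeff ν Λ m).1| + |(radialCoeff ν Λ m).2|) * r ^ m :=
  summable_mul_pow_of_le_mul (fun _ => by positivity) (abs_radialCoeff_succ_le hν Λ) hr.1 hr.2

theorem hasFPowerSeriesOnBall_radialProfile (hν : 0 < ν) (Λ : ℝ) :
    HasFPowerSeriesOnBall (radialProfile ν Λ)
      (FormalMultilinearSeries.ofScalars ℝ fun m => (radialCoeff ν Λ m).1) 0 1 :=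
  hasFPowerSeriesOnBall_ofScalarsSum fun r hr =>
    (summable_abs_radialCoeff_mul_pow hν Λ hr).of_nonneg_of_le
      (fun m => mul_nonneg (abs_nonneg _) (pow_nonneg hr.1 m))
      (fun m => mul_le_mul_of_nonneg_right (by simp) (pow_nonneg hr.1 m))

theorem hasFPowerSeriesOnBall_radialMomentum (hν : 0 < ν) (Λ : ℝ) :
    HasFPowerSeriesOnBall (radialMomentum ν Λ)
      (FormalMultilinearSeries.ofScalars ℝ fun m => (radialCoeff ν Λ m).2) 0 1 :=
  hasFPowerSeriesOnBall_ofScalarsSum fun r hr =>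
    (summable_abs_radialCoeff_mul_pow hν Λ hr).of_nonneg_of_le
      (fun m => mul_nonneg (abs_nonneg _) (pow_nonneg hr.1 m))
      (fun m => mul_le_mul_of_nonneg_right (by simp) (pow_nonneg hr.1 m))

theorem radialProfile_zero (ν Λ : ℝ) : radialProfile ν Λ 0 = 1 := by
  simp [radialProfile, radialCoeff]

theorem contDiffOn_radialProfile (hν : 0 < ν) (Λ : ℝ) :
    ContDiffOn ℝ 2 (radialProfile ν Λ) (Metric.ball 0 1) := by
  have h := (hasFPowerSeriesOnBall_radialProfile hν Λ).analyticOnNhd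
  rw [← ENNReal.ofReal_one, Metric.eball_ofReal] at h
  exact h.contDiffOn Metric.isOpen_ball.uniqueDiffOn

theorem hasDerivAt_radialProfile (hν : 0 < ν) (Λ : ℝ) (ht : |t| < 1) :
    HasDerivAt (radialProfile ν Λ) (radialMomentum ν Λ t / (1 - t)) t := by
  have hh := hasFPowerSeriesOnBall_radialProfile hν Λ
  have hp := hasFPowerSeriesOnBall_radialMomentum hν Λ
  suffices hderiv : (1 - t) * deriv (radialProfile ν Λ) t = radialMomentum ν Λ t by
    have ht1 : 1 - t ≠ 0 := by linarith [(abs_lt.1 ht).2]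
    rw [← hderiv, mul_div_cancel_left₀ _ ht1]
    exact (differentiableAt_of_hasFPowerSeriesOnBall hh ht).hasDerivAt
  rcases eq_or_ne t 0 with rfl | ht0
  · simp [hh.hasFPowerSeriesAt.deriv, radialMomentum, radialCoeff]
  have hEuler := hasSum_natCast_mul_mul_pow hh ht
  have hshift : t * deriv (radialProfile ν Λ) t =
      t * (t * deriv (radialProfile ν Λ) t + radialMomentum ν Λ t) := by
    refine eq_mul_of_hasSum_of_succ (by simp) (fun m => ?_) hEuler
      (by simpa only [← add_mul] using hEuler.add (hasSum_mul_pow hp ht))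
    exact_mod_cast add_one_mul_radialCoeff_fst_succ ν Λ m
  exact mul_left_cancel₀ ht0 (by linarith)

theorem radialMomentum_equation (hν : 0 < ν) (Λ : ℝ) (ht : |t| < 1) :
    t * (1 - t) * deriv (radialMomentum ν Λ) t + (ν + (ν - 1) * t) * radialMomentum ν Λ t +
      Λ * radialProfile ν Λ t = 0 := by
  have hh := hasSum_mul_pow (hasFPowerSeriesOnBall_radialProfile hν Λ) ht
  have hp := hasSum_mul_pow (hasFPowerSeriesOnBall_radialMomentum hν Λ) ht
  have hEuler := hasSum_natCast_mul_mul_pow (hasFPowerSeriesOnBall_radialMomentum hν Λ) ht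
  have hshift : t * deriv (radialMomentum ν Λ) t + ν * radialMomentum ν Λ t +
      Λ * radialProfile ν Λ t =
      t * (t * deriv (radialMomentum ν Λ) t + (1 - ν) * radialMomentum ν Λ t) := by
    refine eq_mul_of_hasSum_of_succ ?_ (fun m => ?_)
      (by simpa only [← mul_assoc, ← add_mul] using
        (hEuler.add (hp.mul_left ν)).add (hh.mul_left Λ))
      (by simpa only [← mul_assoc, ← add_mul] using hEuler.add (hp.mul_left (1 - ν)))
    · simp [radialCoeff, mul_div_cancel₀ _ hν.ne']
    · push_cast
      linarith [add_one_add_mul_radialCoeff_snd_succ hν Λ m]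
  linarith

end Existence

section EuclideanLaplacian

open InnerProductSpace Laplacian

variable {E : Type*} [NormedAddCommGroup E] [InnerProductSpace ℝ E] {f : E → ℝ} {x : E}

theorem differentiableAt_fderiv_apply (hf : ContDiffAt ℝ 2 f x) (v : E) :
    DifferentiableAt ℝ (fun y => fderiv ℝ f y v) x :=
  ((hf.fderiv_right (m := 1) (by norm_num)).differentiableAt one_ne_zero).clm_apply
    (differentiableAt_const v)

theorem fderiv_eventuallyEq_comp_norm_sq {F F' : ℝ → ℝ}
    (hf : ∀ᶠ y in 𝓝 x, f y = F (‖y‖ ^ 2)) (hF : ∀ᶠ s in 𝓝 (‖x‖ ^ 2), HasDerivAt F (F' s) s) :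
    fderiv ℝ f =ᶠ[𝓝 x] fun y => (2 * F' (‖y‖ ^ 2)) • innerSL ℝ y := by
  have hcont : Continuous fun y : E => ‖y‖ ^ 2 := by fun_prop
  filter_upwards [hf.eventually_nhds, hcont.continuousAt.eventually hF] with y hfy hFy
  have hcomp : HasFDerivAt (fun z : E => F (‖z‖ ^ 2)) _ y :=
    hFy.comp_hasFDerivAt y (hasStrictFDerivAt_norm_sq y).hasFDerivAt
  rw [EventuallyEq.fderiv_eq hfy, hcomp.fderiv, ← Nat.cast_smul_eq_nsmul ℝ, smul_smul, mul_comm,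
    Nat.cast_ofNat]

variable [FiniteDimensional ℝ E]

theorem laplacian_eq_sum_fderiv_fderiv {ι : Type*} [Fintype ι] (v : OrthonormalBasis ι ℝ E)
    (hf : ContDiffAt ℝ 2 f x) :
    Δ f x = ∑ i, fderiv ℝ (fun y => fderiv ℝ f y (v i)) x (v i) := by
  have hf' : DifferentiableAt ℝ (fderiv ℝ f) x :=
    (hf.fderiv_right (m := 1) (by norm_num)).differentiableAt one_ne_zero
  simp [laplacian_eq_iteratedFDeriv_orthonormalBasis f v, iteratedFDeriv_two_apply,
    fderiv_clm_apply hf' (differentiableAt_const _)]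

theorem laplacian_of_eventuallyEq_comp_norm_sq {F F' : ℝ → ℝ} {F'' : ℝ}
    (hf : ContDiffAt ℝ 2 f x) (hfF : ∀ᶠ y in 𝓝 x, f y = F (‖y‖ ^ 2))
    (hF : ∀ᶠ s in 𝓝 (‖x‖ ^ 2), HasDerivAt F (F' s) s) (hF' : HasDerivAt F' F'' (‖x‖ ^ 2)) :
    Δ f x = 4 * ‖x‖ ^ 2 * F'' + 2 * Module.finrank ℝ E * F' (‖x‖ ^ 2) := by
  let e := stdOrthonormalBasis ℝ E
  have hsecond : ∀ v : E, fderiv ℝ (fun y => fderiv ℝ f y v) x v =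
      4 * F'' * inner ℝ x v ^ 2 + 2 * F' (‖x‖ ^ 2) * ‖v‖ ^ 2 := fun v => by
    have hfirst : (fun y => fderiv ℝ f y v) =ᶠ[𝓝 x] fun y => 2 * F' (‖y‖ ^ 2) * inner ℝ v y := by
      filter_upwards [fderiv_eventuallyEq_comp_norm_sq hfF hF] with y hy
      simp [hy, real_inner_comm]
    have hproduct : HasFDerivAt (fun y => 2 * F' (‖y‖ ^ 2) * inner ℝ v y) _ x :=
      ((hF'.comp_hasFDerivAt x (hasStrictFDerivAt_norm_sq x).hasFDerivAt).const_mul 2).mul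
        (innerSL ℝ v).hasFDerivAt
    rw [hfirst.fderiv_eq, hproduct.fderiv]
    simp [real_inner_comm]
    ring
  rw [laplacian_eq_sum_fderiv_fderiv e hf]
  simp only [hsecond, Finset.sum_add_distrib, ← Finset.mul_sum, e.sum_sq_inner_left, e.norm_eq_one]
  simp
  ring

theorem deriv_deriv_nonpos_of_isLocalMax {g : ℝ → ℝ} {a : ℝ} (hg : ContinuousAt g a)
    (hmax : IsLocalMax g a) : deriv (deriv g) a ≤ 0 := by
  by_contra! hpos
  have hmin : IsLocalMin g a := isLocalMin_of_deriv_deriv_pos hpos hmax.deriv_eq_zero hg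
  have hconst : g =ᶠ[𝓝 a] fun _ => g a := by
    filter_upwards [hmax, hmin] with s hle hge using le_antisymm hle hge
  rw [hconst.deriv.deriv_eq] at hpos
  simp at hpos

theorem laplacian_nonpos_of_isLocalMax (hf : ContDiffAt ℝ 2 f x) (hmax : IsLocalMax f x) :
    Δ f x ≤ 0 := by
  rw [laplacian_eq_sum_fderiv_fderiv (stdOrthonormalBasis ℝ E) hf]
  refine Finset.sum_nonpos fun i _ => ?_
  set v := stdOrthonormalBasis ℝ E i
  let line : ℝ → E := fun s => x + s • v
  have hline : ∀ s, HasDerivAt line v s := fun s =>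
    (((hasDerivAt_id s).smul_const v).const_add x).congr_deriv (one_smul ℝ v)
  have hline0 : line 0 = x := by simp [line]
  have hlim : Tendsto line (𝓝 0) (𝓝 x) := hline0 ▸ (hline 0).continuousAt.tendsto
  have hderiv : deriv (f ∘ line) =ᶠ[𝓝 0] fun s => fderiv ℝ f (line s) v := by
    filter_upwards [hlim.eventually (hf.eventually (by simp))] with s hs
    exact ((hs.differentiableAt two_ne_zero).hasFDerivAt.comp_hasDerivAt s (hline s)).deriv
  have hsecond : HasDerivAt (fun s => fderiv ℝ f (line s) v)
      (fderiv ℝ (fun y => fderiv ℝ f y v) x v) 0 :=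
    (differentiableAt_fderiv_apply hf v).hasFDerivAt.comp_hasDerivAt_of_eq 0 (hline 0) hline0.symm
  rw [← hsecond.deriv, ← hderiv.deriv_eq]
  refine deriv_deriv_nonpos_of_isLocalMax ?_ ?_
  · exact ContinuousAt.comp (hline0.symm ▸ hf.continuousAt) (hline 0).continuousAt
  · simpa [IsLocalMax, IsMaxFilter, hline0] using hlim.eventually hmax

end EuclideanLaplacian

section ConformalMetric

open InnerProductSpace Laplacian

variable {n : ℕ} {f : EuclideanSpace ℝ (Fin n) → ℝ} {x : EuclideanSpace ℝ (Fin n)}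

theorem laplaceBeltrami_const (g : EuclideanSpace ℝ (Fin n) → Matrix (Fin n) (Fin n) ℝ) (c : ℝ) :
    laplaceBeltrami g (fun _ => c) x = 0 := by
  simp [laplaceBeltrami]

theorem sqrt_det_sq_smul_one {c : ℝ} (hc : 0 ≤ c) :
    √(c ^ 2 • (1 : Matrix (Fin n) (Fin n) ℝ)).det = c ^ n := by
  rw [Matrix.det_smul, Matrix.det_one, mul_one, Fintype.card_fin, pow_right_comm,
    Real.sqrt_sq (pow_nonneg hc n)]

theorem inv_smul_one {c : ℝ} (hc : c ≠ 0) :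
    (c • (1 : Matrix (Fin n) (Fin n) ℝ))⁻¹ = c⁻¹ • (1 : Matrix (Fin n) (Fin n) ℝ) :=
  Matrix.inv_eq_right_inv (by simp [smul_smul, hc])

theorem laplaceBeltrami_conformal {g : EuclideanSpace ℝ (Fin n) → Matrix (Fin n) (Fin n) ℝ}
    {σ : EuclideanSpace ℝ (Fin n) → ℝ} {w : EuclideanSpace ℝ (Fin n)}
    (hg : ∀ᶠ y in 𝓝 x, 0 < σ y ∧ g y = σ y ^ 2 • (1 : Matrix (Fin n) (Fin n) ℝ))
    (hσ : HasGradientAt σ w x) (hf : ContDiffAt ℝ 2 f x) :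
    laplaceBeltrami g f x = (σ x)⁻¹ ^ 2 * (Δ f x + (n - 2) / σ x * fderiv ℝ f x w) := by
  obtain ⟨hσx, hgx⟩ := hg.self_of_nhds
  let e := EuclideanSpace.basisFun (Fin n) ℝ
  have hweight : HasFDerivAt (fun y => σ y ^ (n - 2 : ℤ)) _ x :=
    (hasDerivAt_zpow (n - 2 : ℤ) (σ x) (Or.inl hσx.ne')).comp_hasFDerivAt x hσ.hasFDerivAt
  have hflux : ∀ i, (fun y => √(g y).det * ∑ j, (g y)⁻¹ i j * fderiv ℝ f y (e j)) =ᶠ[𝓝 x]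
      fun y => σ y ^ (n - 2 : ℤ) * fderiv ℝ f y (e i) := fun i => by
    filter_upwards [hg] with y ⟨hσy, hgy⟩
    rw [hgy, sqrt_det_sq_smul_one hσy.le, inv_smul_one (by positivity), zpow_sub₀ hσy.ne']
    simp [Matrix.one_apply]
    ring
  have hdivergence : ∀ i, fderiv ℝ (fun y => √(g y).det * ∑ j, (g y)⁻¹ i j * fderiv ℝ f y (e j)) x
      (e i) = σ x ^ (n - 2 : ℤ) * (fderiv ℝ (fun y => fderiv ℝ f y (e i)) x (e i) +
        (n - 2) / σ x * (w i * fderiv ℝ f x (e i))) := fun i => by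
    rw [(hflux i).fderiv_eq, fderiv_fun_mul hweight.differentiableAt
      (differentiableAt_fderiv_apply hf (e i)), hweight.fderiv]
    simp [e, EuclideanSpace.inner_single_right, zpow_sub_one₀ hσx.ne']
    ring
  have hgradient : ∑ i, w i * fderiv ℝ f x (e i) = fderiv ℝ f x w := by
    conv_rhs => rw [← e.sum_repr w]
    simp [e]
  simp only [e, EuclideanSpace.basisFun_apply] at hdivergence hgradient
  rw [laplaceBeltrami, Finset.sum_congr rfl fun i _ => hdivergence i, ← Finset.mul_sum,
    Finset.sum_add_distrib, ← Finset.mul_sum, hgradient, laplacian_eq_sum_fderiv_fderiv e hf, hgx,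
    sqrt_det_sq_smul_one hσx.le, ← mul_assoc, zpow_sub₀ hσx.ne']
  simp only [e, EuclideanSpace.basisFun_apply, zpow_natCast]
  field_simp

end ConformalMetric

section HyperbolicBall

open InnerProductSpace Laplacian

variable {n : ℕ} {ρ : ℝ} {f : EuclideanSpace ℝ (Fin n) → ℝ} {x : EuclideanSpace ℝ (Fin n)}

theorem sq_norm_lt_sq (hx : x ∈ Metric.ball 0 ρ) : ‖x‖ ^ 2 < ρ ^ 2 :=
  pow_lt_pow_left₀ (mem_ball_zero_iff.1 hx) (norm_nonneg x) two_ne_zero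

theorem hasGradientAt_conformalFactor (hx : ‖x‖ ^ 2 ≠ ρ ^ 2) :
    HasGradientAt (fun y => 2 * ρ ^ 2 / (ρ ^ 2 - ‖y‖ ^ 2))
      ((4 * ρ ^ 2 / (ρ ^ 2 - ‖x‖ ^ 2) ^ 2) • x) x := by
  have hne : ρ ^ 2 - ‖x‖ ^ 2 ≠ 0 := sub_ne_zero.2 hx.symm
  have hquotient : HasDerivAt (fun s => 2 * ρ ^ 2 / (ρ ^ 2 - s))
      (2 * ρ ^ 2 / (ρ ^ 2 - ‖x‖ ^ 2) ^ 2) (‖x‖ ^ 2) := by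
    simpa using (hasDerivAt_const (‖x‖ ^ 2) (2 * ρ ^ 2)).fun_div
      ((hasDerivAt_id (‖x‖ ^ 2)).const_sub (ρ ^ 2)) hne
  rw [hasGradientAt_iff_hasFDerivAt]
  refine (hquotient.comp_hasFDerivAt x
    (hasStrictFDerivAt_norm_sq x).hasFDerivAt).congr_fderiv ?_
  ext v
  simp
  ring

theorem laplaceBeltrami_ballMetric (hx : x ∈ Metric.ball 0 ρ) (hf : ContDiffAt ℝ 2 f x) :
    laplaceBeltrami (ballMetric n ρ) f x = ((ρ ^ 2 - ‖x‖ ^ 2) / (2 * ρ ^ 2)) ^ 2 *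
      (Δ f x + 2 * (n - 2) / (ρ ^ 2 - ‖x‖ ^ 2) * fderiv ℝ f x x) := by
  have hρ : 0 < ρ := Metric.pos_of_mem_ball hx
  have hconformal : ∀ᶠ y in 𝓝 x, 0 < 2 * ρ ^ 2 / (ρ ^ 2 - ‖y‖ ^ 2) ∧ ballMetric n ρ y =
      (2 * ρ ^ 2 / (ρ ^ 2 - ‖y‖ ^ 2)) ^ 2 • (1 : Matrix (Fin n) (Fin n) ℝ) := by
    filter_upwards [Metric.isOpen_ball.mem_nhds hx] with y hy
    exact ⟨div_pos (by positivity) (sub_pos.2 (sq_norm_lt_sq hy)), rfl⟩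
  have hgap : 0 < ρ ^ 2 - ‖x‖ ^ 2 := sub_pos.2 (sq_norm_lt_sq hx)
  rw [laplaceBeltrami_conformal hconformal (hasGradientAt_conformalFactor (sq_norm_lt_sq hx).ne) hf,
    map_smul, smul_eq_mul, inv_div]
  field_simp
  ring

theorem laplaceBeltrami_ballMetric_radial {h p : ℝ → ℝ} {p' t : ℝ} (hx : x ∈ Metric.ball 0 ρ)
    (hf : ContDiffAt ℝ 2 f x) (hfh : ∀ᶠ y in 𝓝 x, f y = h (‖y‖ ^ 2 / ρ ^ 2))
    (ht : t = ‖x‖ ^ 2 / ρ ^ 2) (hh : ∀ᶠ s in 𝓝 t, HasDerivAt h (p s / (1 - s)) s)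
    (hp : HasDerivAt p p' t) :
    ρ ^ 2 * laplaceBeltrami (ballMetric n ρ) f x =
      t * (1 - t) * p' + (n / 2 + (n / 2 - 1) * t) * p t := by
  subst ht
  have hρ : 0 < ρ := Metric.pos_of_mem_ball hx
  have hgap : 0 < ρ ^ 2 - ‖x‖ ^ 2 := sub_pos.2 (sq_norm_lt_sq hx)
  have hscale : ∀ s, HasDerivAt (fun s => s / ρ ^ 2) (1 / ρ ^ 2) s := fun s =>
    (hasDerivAt_id s).div_const _
  have hF : ∀ᶠ s in 𝓝 (‖x‖ ^ 2), HasDerivAt (fun s => h (s / ρ ^ 2))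
      (p (s / ρ ^ 2) / (1 - s / ρ ^ 2) * (1 / ρ ^ 2)) s := by
    filter_upwards [(hscale _).continuousAt.eventually hh] with s hs using hs.comp s (hscale s)
  have hF' := ((hp.comp (‖x‖ ^ 2) (hscale _)).fun_div ((hscale _).const_sub 1)
    (x := ‖x‖ ^ 2) (by field_simp; simpa [hρ.ne'] using hgap.ne')).mul_const (1 / ρ ^ 2)
  rw [laplaceBeltrami_ballMetric hx hf, laplacian_of_eventuallyEq_comp_norm_sq hf hfh hF hF',
    (fderiv_eventuallyEq_comp_norm_sq hfh hF).self_of_nhds]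
  simp
  field_simp
  ring

theorem laplaceBeltrami_ballMetric_neg_of_isLocalMax_add_norm_sq (hn : 2 ≤ n) {ε : ℝ} (hε : 0 < ε)
    (hx : x ∈ Metric.ball 0 ρ) (hf : ContDiffAt ℝ 2 f x)
    (hmax : IsLocalMax (fun y => f y + ε * ‖y‖ ^ 2) x) :
    laplaceBeltrami (ballMetric n ρ) f x < 0 := by
  have hn' : (2 : ℝ) ≤ n := mod_cast hn
  have hρ : 0 < ρ := Metric.pos_of_mem_ball hx
  have hgap : 0 < ρ ^ 2 - ‖x‖ ^ 2 := sub_pos.2 (sq_norm_lt_sq hx)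
  let Q : EuclideanSpace ℝ (Fin n) → ℝ := fun y => ε * ‖y‖ ^ 2
  have hQ : ContDiffAt ℝ 2 Q x := (contDiff_const.mul (contDiff_norm_sq ℝ)).contDiffAt
  have hlinear : ∀ s, HasDerivAt (fun s => ε * s) ε s := fun s => by
    simpa using (hasDerivAt_id s).const_mul ε
  have hΔQ : Δ Q x = 2 * n * ε := by
    simpa using laplacian_of_eventuallyEq_comp_norm_sq hQ (.of_forall fun _ => rfl)
      (.of_forall hlinear) (hasDerivAt_const _ ε)
  have hDQ : fderiv ℝ Q x x = 2 * ε * ‖x‖ ^ 2 := by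
    simpa using congrArg (fun D => D x) (fderiv_eventuallyEq_comp_norm_sq (f := Q) (x := x)
      (.of_forall fun _ => rfl) (.of_forall hlinear)).self_of_nhds
  have hlaplacian : Δ f x ≤ -(2 * n * ε) := by
    have hnonpos : Δ (f + Q) x ≤ 0 := laplacian_nonpos_of_isLocalMax (hf.add hQ) hmax
    rw [hf.laplacian_add hQ, hΔQ] at hnonpos
    linarith
  have hdrift : fderiv ℝ f x x = -(2 * ε * ‖x‖ ^ 2) := by
    have hzero := congrArg (fun D => D x) hmax.fderiv_eq_zero
    rw [fderiv_fun_add (hf.differentiableAt two_ne_zero) (hQ.differentiableAt two_ne_zero)] at hzero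
    simp only [add_apply, hDQ, zero_apply] at hzero
    linarith
  rw [laplaceBeltrami_ballMetric hx hf, hdrift]
  refine mul_neg_of_pos_of_neg (by positivity) ?_
  have hcoeff : 0 ≤ 2 * (n - 2) / (ρ ^ 2 - ‖x‖ ^ 2) * (2 * ε * ‖x‖ ^ 2) :=
    mul_nonneg (div_nonneg (by linarith) hgap.le) (by positivity)
  have hpos : 0 < 2 * n * ε := by positivity
  linarith

theorem le_of_forall_sphere_le (hn : 2 ≤ n) {s M : ℝ} (hs : s < ρ)
    (hf : ContDiffOn ℝ 2 f (Metric.ball 0 ρ))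
    (hsub : ∀ y ∈ Metric.ball 0 s, M < f y → 0 ≤ laplaceBeltrami (ballMetric n ρ) f y)
    (hsphere : ∀ y ∈ Metric.sphere 0 s, f y ≤ M) (hx : x ∈ Metric.closedBall 0 s) : f x ≤ M := by
  by_contra! hM
  have : 0 ≤ s := Metric.nonneg_of_mem_closedBall hx
  obtain ⟨ε, hε, hεM⟩ : ∃ ε > 0, ε * s ^ 2 < f x - M :=
    ⟨(f x - M) / (2 * (s ^ 2 + 1)), div_pos (sub_pos.2 hM) (by positivity), by
      rw [div_mul_eq_mul_div, div_lt_iff₀ (by positivity)]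
      nlinarith [sq_nonneg s]⟩
  have hball : Metric.closedBall (0 : EuclideanSpace ℝ (Fin n)) s ⊆ Metric.ball 0 ρ :=
    Metric.closedBall_subset_ball hs
  have hcont : ContinuousOn (fun y => f y + ε * ‖y‖ ^ 2) (Metric.closedBall 0 s) :=
    (hf.continuousOn.mono hball).add (by fun_prop)
  obtain ⟨y, hy, hmax⟩ := (isCompact_closedBall (0 : EuclideanSpace ℝ (Fin n)) s).exists_isMaxOn
    ⟨x, hx⟩ hcont
  have hfy : M < f y := by
    have hxy : f x + ε * ‖x‖ ^ 2 ≤ f y + ε * ‖y‖ ^ 2 := hmax hx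
    have hys : ε * ‖y‖ ^ 2 ≤ ε * s ^ 2 := by gcongr; simpa using hy
    have hx0 : 0 ≤ ε * ‖x‖ ^ 2 := by positivity
    linarith
  have hyball : y ∈ Metric.ball 0 s :=
    mem_ball_zero_iff.2 ((mem_closedBall_zero_iff.1 hy).lt_of_ne fun h =>
      (hsphere y (mem_sphere_zero_iff_norm.2 h)).not_gt hfy)
  refine (hsub y hyball hfy).not_gt (laplaceBeltrami_ballMetric_neg_of_isLocalMax_add_norm_sq hn hε
    (hball hy) (hf.contDiffAt (Metric.isOpen_ball.mem_nhds (hball hy))) ?_)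
  exact hmax.isLocalMax (mem_of_superset (Metric.isOpen_ball.mem_nhds hyball)
    Metric.ball_subset_closedBall)

end HyperbolicBall

section HyperbolicRadius

variable {n : ℕ} {ρ τ : ℝ} {f : EuclideanSpace ℝ (Fin n) → ℝ} {x : EuclideanSpace ℝ (Fin n)}

theorem hasDerivAt_artanh {s : ℝ} (hs : s ∈ Set.Ioo (-1) 1) :
    HasDerivAt Real.artanh (1 / (1 - s ^ 2)) s := by
  have hplus : 1 + s ≠ 0 := by linarith [hs.1]
  have hminus : 1 - s ≠ 0 := by linarith [hs.2]
  have hlog : HasDerivAt (fun u => 1 / 2 * Real.log ((1 + u) / (1 - u))) (1 / (1 - s ^ 2)) s := by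
    refine (((((hasDerivAt_id s).const_add 1).fun_div ((hasDerivAt_id s).const_sub 1) hminus).log
      (div_ne_zero hplus hminus)).const_mul (1 / 2)).congr_deriv ?_
    rw [show 1 - s ^ 2 = (1 + s) * (1 - s) by ring]
    simp only [id_eq]
    field_simp
    ring
  refine hlog.congr_of_eventuallyEq ?_
  filter_upwards [isOpen_Ioo.mem_nhds hs] with u hu
    using Real.artanh_eq_half_log (Set.Ioo_subset_Icc_self hu)

theorem hasDerivAt_two_mul_artanh_sqrt {t : ℝ} (ht : t ∈ Set.Ioo 0 1) :
    HasDerivAt (fun s => 2 * Real.artanh √s) (1 / (√t * (1 - t))) t := by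
  have hsqrt : √t ∈ Set.Ioo (-1) 1 :=
    ⟨by linarith [Real.sqrt_nonneg t], by simpa using Real.sqrt_lt_sqrt ht.1.le ht.2⟩
  refine (((hasDerivAt_artanh hsqrt).comp t (Real.hasDerivAt_sqrt ht.1.ne')).const_mul
    2).congr_deriv ?_
  rw [Real.sq_sqrt ht.1.le]
  field_simp

theorem tanh_half_pos (hτ : 0 < τ) : 0 < Real.tanh (τ / 2) := by
  rw [Real.tanh_eq_sinh_div_cosh]
  exact div_pos (Real.sinh_pos_iff.2 (half_pos hτ)) (Real.cosh_pos _)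

theorem cosh_div_sinh_eq_tanh_half (hτ : 0 < τ) : Real.cosh τ / Real.sinh τ =
    (1 + Real.tanh (τ / 2) ^ 2) / (2 * Real.tanh (τ / 2)) := by
  have : 0 < Real.sinh (τ / 2) := Real.sinh_pos_iff.2 (half_pos hτ)
  have : 0 < Real.cosh (τ / 2) := Real.cosh_pos _
  have hdouble : τ = 2 * (τ / 2) := by ring
  conv_lhs => rw [hdouble, Real.cosh_two_mul, Real.sinh_two_mul]
  rw [Real.tanh_eq_sinh_div_cosh]
  field_simp

theorem norm_div_mem_Ico (hx : x ∈ Metric.ball 0 ρ) : ‖x‖ / ρ ∈ Set.Ico 0 1 :=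
  have hρ : 0 < ρ := Metric.pos_of_mem_ball hx
  ⟨by positivity, (div_lt_one hρ).2 (mem_ball_zero_iff.1 hx)⟩

theorem hypRadius_eq_mul_artanh (hx : x ∈ Metric.ball 0 ρ) :
    hypRadius ρ x = ρ * (2 * Real.artanh (‖x‖ / ρ)) := by
  have hρ : 0 < ρ := Metric.pos_of_mem_ball hx
  have hmem := norm_div_mem_Ico hx
  rw [Real.artanh_eq_half_log ⟨by linarith [hmem.1], hmem.2.le⟩, hypRadius,
    one_add_div hρ.ne', one_sub_div hρ.ne', div_div_div_cancel_right₀ hρ.ne']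
  ring

theorem tanh_hypRadius (hx : x ∈ Metric.ball 0 ρ) :
    Real.tanh (hypRadius ρ x / (2 * ρ)) = ‖x‖ / ρ := by
  have hρ : 0 < ρ := Metric.pos_of_mem_ball hx
  have hmem := norm_div_mem_Ico hx
  rw [hypRadius_eq_mul_artanh hx, show ρ * (2 * Real.artanh (‖x‖ / ρ)) / (2 * ρ) =
    Real.artanh (‖x‖ / ρ) by field_simp, Real.tanh_artanh ⟨by linarith [hmem.1], hmem.2⟩]

theorem mem_ball_of_norm_eq (hρ : 0 < ρ) (hx : ‖x‖ = ρ * Real.tanh (τ / 2)) :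
    x ∈ Metric.ball 0 ρ :=
  mem_ball_zero_iff.2 (hx ▸ mul_lt_of_lt_one_right hρ (Real.tanh_lt_one _))

theorem hypRadius_of_norm_eq (hρ : 0 < ρ) (hx : ‖x‖ = ρ * Real.tanh (τ / 2)) :
    hypRadius ρ x = ρ * τ := by
  rw [hypRadius_eq_mul_artanh (mem_ball_of_norm_eq hρ hx), hx, mul_div_cancel_left₀ _ hρ.ne',
    Real.artanh_tanh, mul_div_cancel₀ _ two_ne_zero]

theorem laplaceBeltrami_ballMetric_hypRadius {H q : ℝ → ℝ} {q' : ℝ} (hρ : 0 < ρ) (hτ : 0 < τ)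
    (hx : ‖x‖ = ρ * Real.tanh (τ / 2)) (hf : ContDiffAt ℝ 2 f x)
    (hfH : ∀ᶠ y in 𝓝 x, f y = H (hypRadius ρ y / ρ)) (hH : ∀ᶠ s in 𝓝 τ, HasDerivAt H (q s) s)
    (hq : HasDerivAt q q' τ) :
    ρ ^ 2 * laplaceBeltrami (ballMetric n ρ) f x =
      q' + (n - 1) * (Real.cosh τ / Real.sinh τ) * q τ := by
  have hball : x ∈ Metric.ball 0 ρ := mem_ball_of_norm_eq hρ hx
  have hT : 0 < Real.tanh (τ / 2) := tanh_half_pos hτ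
  have hmem : Real.tanh (τ / 2) ^ 2 ∈ Set.Ioo 0 1 := ⟨by positivity, Real.tanh_sq_lt_one _⟩
  have hsqrt : √(Real.tanh (τ / 2) ^ 2) = Real.tanh (τ / 2) := Real.sqrt_sq hT.le
  let θ : ℝ → ℝ := fun s => 2 * Real.artanh √s
  have hθT : θ (Real.tanh (τ / 2) ^ 2) = τ := by
    rw [show θ _ = 2 * Real.artanh √_ from rfl, hsqrt, Real.artanh_tanh,
      mul_div_cancel₀ _ two_ne_zero]
  have hθ : ∀ s ∈ Set.Ioo (0 : ℝ) 1, HasDerivAt θ (1 / (√s * (1 - s))) s := fun s =>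
    hasDerivAt_two_mul_artanh_sqrt
  have hprofile : ∀ᶠ y in 𝓝 x, f y = (H ∘ θ) (‖y‖ ^ 2 / ρ ^ 2) := by
    filter_upwards [hfH, Metric.isOpen_ball.mem_nhds hball] with y hy hyball
    simp only [hy, hypRadius_eq_mul_artanh hyball, mul_div_cancel_left₀ _ hρ.ne', ← div_pow,
      Function.comp_apply, θ, Real.sqrt_sq (norm_div_mem_Ico hyball).1]
  have hfirst : ∀ᶠ s in 𝓝 (Real.tanh (τ / 2) ^ 2),
      HasDerivAt (H ∘ θ) (q (θ s) / √s / (1 - s)) s := by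
    have hlim : Tendsto θ (𝓝 (Real.tanh (τ / 2) ^ 2)) (𝓝 τ) := by
      simpa only [hθT] using (hθ _ hmem).continuousAt.tendsto
    filter_upwards [hlim.eventually hH, isOpen_Ioo.mem_nhds hmem] with s hs hsmem
    refine (hs.comp s (hθ s hsmem)).congr_deriv ?_
    rw [mul_one_div, div_div]
  have hsecond : HasDerivAt (fun s => q (θ s) / √s) _ (Real.tanh (τ / 2) ^ 2) :=
    (hq.comp_of_eq _ (hθ _ hmem) hθT.symm).fun_div (Real.hasDerivAt_sqrt hmem.1.ne')
      (by rw [hsqrt]; exact hT.ne')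
  rw [laplaceBeltrami_ballMetric_radial hball hf hprofile
    (by rw [hx, mul_pow, mul_div_cancel_left₀ _ (by positivity)]) hfirst hsecond,
    cosh_div_sinh_eq_tanh_half hτ]
  simp only [Function.comp_apply, hθT, hsqrt]
  have hgap : 0 < 1 - Real.tanh (τ / 2) ^ 2 := sub_pos.2 hmem.2
  field_simp
  ring

end HyperbolicRadius

section RadialEigenfunctions

variable {n : ℕ} {ρ μ : ℝ} {φ ψ : ℝ → ℝ}

theorem hypRadius_zero (hρ : ρ ≠ 0) : hypRadius ρ (0 : EuclideanSpace ℝ (Fin n)) = 0 := by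
  simp [hypRadius, hρ]

theorem hypRadius_nonneg {x : EuclideanSpace ℝ (Fin n)} (hx : x ∈ Metric.ball 0 ρ) :
    0 ≤ hypRadius ρ x := by
  rw [hypRadius_eq_mul_artanh hx]
  have hρ : 0 < ρ := Metric.pos_of_mem_ball hx
  have := Real.artanh_nonneg (norm_div_mem_Ico hx).1
  positivity

theorem contDiff_tanh {m : WithTop ℕ∞} : ContDiff ℝ m Real.tanh := by
  rw [show Real.tanh = fun τ => Real.sinh τ / Real.cosh τ from funext Real.tanh_eq_sinh_div_cosh]
  exact Real.contDiff_sinh.div Real.contDiff_cosh fun τ => (Real.cosh_pos τ).ne'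

theorem deriv_zero_of_even {H : ℝ → ℝ} (hH : ∀ τ, H (-τ) = H τ) : deriv H 0 = 0 := by
  have hneg : deriv (fun τ => H (-τ)) 0 = -deriv H (-0) := deriv_comp_neg H 0
  simp only [hH, neg_zero] at hneg
  linarith

theorem abs_tanh (τ : ℝ) : |Real.tanh τ| = Real.tanh |τ| := by
  rw [Real.tanh_eq_sinh_div_cosh, Real.tanh_eq_sinh_div_cosh, abs_div, Real.abs_sinh, Real.cosh_abs,
    abs_of_pos (Real.cosh_pos τ)]

theorem exists_contDiff_even_extension (hn : 0 < n) (hρ : 0 < ρ)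
    (hψ : ContDiffOn ℝ 2 (fun x : EuclideanSpace ℝ (Fin n) => ψ (hypRadius ρ x))
      (Metric.ball 0 ρ)) :
    ∃ H : ℝ → ℝ, ContDiff ℝ 2 H ∧ (∀ τ, H (-τ) = H τ) ∧ ∀ τ, 0 ≤ τ → H τ = ψ (ρ * τ) := by
  let e : EuclideanSpace ℝ (Fin n) := EuclideanSpace.single ⟨0, hn⟩ 1
  let γ : ℝ → EuclideanSpace ℝ (Fin n) := fun τ => (ρ * Real.tanh (τ / 2)) • e
  have hnorm : ∀ τ, ‖γ τ‖ = ρ * Real.tanh (|τ| / 2) := fun τ => by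
    rw [norm_smul, PiLp.norm_single, norm_one, mul_one, norm_mul, Real.norm_eq_abs ρ,
      abs_of_pos hρ, Real.norm_eq_abs, abs_tanh, abs_div, abs_two]
  have hγ : ContDiff ℝ 2 γ :=
    (contDiff_const.mul (contDiff_tanh.comp (contDiff_id.div_const 2))).smul contDiff_const
  have hradius : ∀ τ, hypRadius ρ (γ τ) = ρ * |τ| := fun τ => hypRadius_of_norm_eq hρ (hnorm τ)
  refine ⟨fun τ => ψ (hypRadius ρ (γ τ)), ?_, fun τ => ?_, fun τ hτ => ?_⟩
  · exact contDiffOn_univ.1 (hψ.comp hγ.contDiffOn fun τ _ => mem_ball_of_norm_eq hρ (hnorm τ))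
  · simp only [hradius, abs_neg]
  · simp only [hradius, abs_of_nonneg hτ]

theorem exists_isRadialSolution (hn : 0 < n) (hρ : 0 < ρ)
    (hψ : SolvesEigenEquation n ρ μ fun x => ψ (hypRadius ρ x)) :
    ∃ q, IsRadialSolution (n - 1) (μ * ρ ^ 2) (ψ 0) (fun τ => ψ (ρ * τ)) q := by
  obtain ⟨H, hH, heven, hHψ⟩ := exists_contDiff_even_extension hn hρ hψ.1
  have hderiv : Differentiable ℝ (deriv H) := (hH.iterate_deriv' 1 1).differentiable one_ne_zero
  have hnear : ∀ τ ∈ Set.Ioi (0 : ℝ), (fun τ => ψ (ρ * τ)) =ᶠ[𝓝 τ] H := fun τ hτ => by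
    filter_upwards [Ioi_mem_nhds hτ] with s hs using (hHψ s (le_of_lt hs)).symm
  have hvelocity : ∀ τ, HasDerivAt H (deriv H τ) τ := fun τ =>
    (hH.differentiable two_ne_zero τ).hasDerivAt
  refine ⟨deriv H, fun τ hτ => (hvelocity τ).congr_of_eventuallyEq (hnear τ hτ), fun τ hτ => ?_,
    ?_, ?_⟩
  · let x : EuclideanSpace ℝ (Fin n) := EuclideanSpace.single ⟨0, hn⟩ (ρ * Real.tanh (τ / 2))
    have hx : ‖x‖ = ρ * Real.tanh (τ / 2) := by
      simp [x, abs_of_pos hρ, abs_of_pos (tanh_half_pos hτ)]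
    have hball : x ∈ Metric.ball 0 ρ := mem_ball_of_norm_eq hρ hx
    have hprofile : ∀ᶠ y in 𝓝 x, ψ (hypRadius ρ y) = H (hypRadius ρ y / ρ) := by
      filter_upwards [Metric.isOpen_ball.mem_nhds hball] with y hy
      rw [hHψ _ (div_nonneg (hypRadius_nonneg hy) hρ.le), mul_div_cancel₀ _ hρ.ne']
    have hoperator := laplaceBeltrami_ballMetric_hypRadius hρ hτ hx
      (hψ.1.contDiffAt (Metric.isOpen_ball.mem_nhds hball)) hprofile (.of_forall hvelocity)
      (hderiv τ).hasDerivAt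
    have hequation := hψ.2 x hball
    simp only [hypRadius_of_norm_eq hρ hx] at hequation
    refine (hderiv τ).hasDerivAt.congr_deriv ?_
    linear_combination ρ ^ 2 * hequation - hoperator
  · have hlim : Tendsto H (𝓝[>] 0) (𝓝 (ψ 0)) := by
      simpa [hHψ 0 le_rfl] using (hH.continuous.tendsto 0).mono_left nhdsWithin_le_nhds
    exact hlim.congr' (eventually_nhdsWithin_of_forall fun τ hτ => hHψ τ (le_of_lt hτ))
  · simpa only [deriv_zero_of_even heven] using
      (hderiv.continuous.tendsto 0).mono_left nhdsWithin_le_nhds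

theorem IsNormalizedRadialEigenfunction.eqOn (hn : 0 < n) (hρ : 0 < ρ)
    (hψ : IsNormalizedRadialEigenfunction n ρ μ ψ) (hφ : IsNormalizedRadialEigenfunction n ρ μ φ) :
    Set.EqOn ψ φ (Set.Ici 0) := by
  obtain ⟨p, hp⟩ := exists_isRadialSolution hn hρ hψ.1
  obtain ⟨q, hq⟩ := exists_isRadialSolution hn hρ hφ.1
  have ha : (0 : ℝ) ≤ n - 1 := sub_nonneg.2 (mod_cast hn)
  rw [hψ.2] at hp
  rw [hφ.2] at hq
  intro r hr
  rcases (Set.mem_Ici.1 hr).eq_or_lt with rfl | hpos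
  · rw [hψ.2, hφ.2]
  · simpa [mul_div_cancel₀ r hρ.ne'] using hp.eqOn ha hq (Set.mem_Ioi.2 (div_pos hpos hρ))

theorem tendsto_of_tendsto_comp_mul {l : Filter ℝ} (hρ : 0 < ρ)
    (h : Tendsto (fun τ => ψ (ρ * τ)) atTop l) : Tendsto ψ atTop l := by
  simpa [Function.comp_def, mul_div_cancel₀ _ hρ.ne'] using
    h.comp (tendsto_id.atTop_div_const hρ)

theorem IsNormalizedRadialEigenfunction.tendsto_atTop (hn : 0 < n) (hρ : 0 < ρ) (hμ : μ < 0)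
    (hφ : IsNormalizedRadialEigenfunction n ρ μ φ) : Tendsto φ atTop atTop := by
  obtain ⟨q, hq⟩ := exists_isRadialSolution hn hρ hφ.1
  refine tendsto_of_tendsto_comp_mul hρ (hq.tendsto_atTop (sub_nonneg.2 (mod_cast hn))
    (mul_neg_of_neg_of_pos hμ (by positivity)) ?_)
  rw [hφ.2]
  exact one_pos

theorem IsNormalizedRadialEigenfunction.tendsto_zero (hn : 1 < n) (hρ : 0 < ρ) (hμ : 0 < μ)
    (hφ : IsNormalizedRadialEigenfunction n ρ μ φ) : Tendsto φ atTop (𝓝 0) := by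
  obtain ⟨q, hq⟩ := exists_isRadialSolution (zero_lt_one.trans hn) hρ hφ.1
  exact tendsto_of_tendsto_comp_mul hρ
    (hq.tendsto_zero (sub_pos.2 (mod_cast hn)) (by positivity))

theorem isNormalizedRadialEigenfunction_one :
    IsNormalizedRadialEigenfunction n ρ 0 fun _ => 1 :=
  ⟨⟨contDiffOn_const, fun x _ => by rw [laplaceBeltrami_const, zero_mul, add_zero]⟩, rfl⟩

theorem IsNormalizedRadialEigenfunction.tendsto_one (hn : 0 < n) (hρ : 0 < ρ)
    (hφ : IsNormalizedRadialEigenfunction n ρ 0 φ) : Tendsto φ atTop (𝓝 1) :=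
  tendsto_const_nhds.congr' ((eventually_ge_atTop 0).mono
    fun _ hr => isNormalizedRadialEigenfunction_one.eqOn hn hρ hφ hr)

/-- The radial eigenfunction of the ball model with value `1` at the origin, as a function of the
hyperbolic radius `r`; here `tanh (r / (2 * ρ)) = |x| / ρ`. -/
noncomputable def radialEigenfunction (n : ℕ) (ρ μ r : ℝ) : ℝ :=
  radialProfile (n / 2) (μ * ρ ^ 2) (Real.tanh (r / (2 * ρ)) ^ 2)

theorem radialEigenfunction_hypRadius {x : EuclideanSpace ℝ (Fin n)} (hx : x ∈ Metric.ball 0 ρ) :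
    radialEigenfunction n ρ μ (hypRadius ρ x) =
      radialProfile (n / 2) (μ * ρ ^ 2) (‖x‖ ^ 2 / ρ ^ 2) := by
  rw [radialEigenfunction, tanh_hypRadius hx, div_pow]

theorem isNormalizedRadialEigenfunction_radialEigenfunction (hn : 0 < n) (hρ : 0 < ρ) :
    IsNormalizedRadialEigenfunction n ρ μ (radialEigenfunction n ρ μ) := by
  have hν : (0 : ℝ) < n / 2 := by positivity
  have hmaps : Set.MapsTo (fun x : EuclideanSpace ℝ (Fin n) => ‖x‖ ^ 2 / ρ ^ 2) (Metric.ball 0 ρ)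
      (Metric.ball 0 1) := fun x hx => by
    rw [mem_ball_zero_iff, Real.norm_of_nonneg (by positivity), div_lt_one (by positivity)]
    exact sq_norm_lt_sq hx
  have hsmooth : ContDiffOn ℝ 2 (fun x : EuclideanSpace ℝ (Fin n) =>
      radialEigenfunction n ρ μ (hypRadius ρ x)) (Metric.ball 0 ρ) :=
    ((contDiffOn_radialProfile hν _).comp ((contDiff_norm_sq ℝ).div_const _).contDiffOn
      hmaps).congr fun x hx => radialEigenfunction_hypRadius hx
  refine ⟨⟨hsmooth, fun x hx => ?_⟩, by simp [radialEigenfunction, radialProfile_zero]⟩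
  have hnhds := Metric.isOpen_ball.mem_nhds hx
  have hmem : ‖x‖ ^ 2 / ρ ^ 2 ∈ Metric.ball 0 1 := hmaps hx
  have hprofile : ∀ᶠ s in 𝓝 (‖x‖ ^ 2 / ρ ^ 2), HasDerivAt (radialProfile (n / 2) (μ * ρ ^ 2))
      (radialMomentum (n / 2) (μ * ρ ^ 2) s / (1 - s)) s := by
    filter_upwards [Metric.isOpen_ball.mem_nhds hmem] with s hs
    exact hasDerivAt_radialProfile hν _ (mem_ball_zero_iff.1 hs)
  have hmomentum := (differentiableAt_of_hasFPowerSeriesOnBall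
    (hasFPowerSeriesOnBall_radialMomentum hν (μ * ρ ^ 2)) (mem_ball_zero_iff.1 hmem)).hasDerivAt
  have hoperator := laplaceBeltrami_ballMetric_radial hx (hsmooth.contDiffAt hnhds)
    (mem_of_superset hnhds fun y hy => radialEigenfunction_hypRadius hy) rfl hprofile hmomentum
  have hequation := radialMomentum_equation hν (μ * ρ ^ 2) (mem_ball_zero_iff.1 hmem)
  simp only [radialEigenfunction_hypRadius hx]
  refine (mul_eq_zero_iff_left (pow_ne_zero 2 hρ.ne')).1 ?_
  linear_combination hoperator + hequation

end RadialEigenfunctions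

section DirichletAtInfinity

variable {n : ℕ} {ρ μ : ℝ}

theorem IsNormalizedRadialEigenfunction.solvesDirichletAtInfinity {φ : ℝ → ℝ} (hρ : 0 < ρ)
    (hφ : IsNormalizedRadialEigenfunction n ρ μ φ) (hlim : Tendsto φ atTop (𝓝 0)) :
    SolvesDirichletAtInfinity n ρ μ fun x => φ (hypRadius ρ x) :=
  ⟨hφ.1, by simp only [hypRadius_zero hρ.ne', hφ.2],
    (hlim.comp tendsto_comap).mono_left inf_le_left⟩

theorem SolvesDirichletAtInfinity.exists_sphere_lt {f : EuclideanSpace ℝ (Fin n) → ℝ} (hρ : 0 < ρ)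
    (hf : SolvesDirichletAtInfinity n ρ μ f) {ε : ℝ} (hε : 0 < ε) :
    ∃ s, 0 ≤ s ∧ s < ρ ∧ ∀ x ∈ Metric.sphere 0 s, f x < ε := by
  have hsmall := hf.2.2.eventually (gt_mem_nhds hε)
  rw [eventually_inf_principal, eventually_comap] at hsmall
  obtain ⟨τ, hτ, hτ0⟩ := (((tendsto_id.const_mul_atTop hρ).eventually hsmall).and
    (eventually_gt_atTop 0)).exists
  refine ⟨ρ * Real.tanh (τ / 2), by have := tanh_half_pos hτ0; positivity,
    mul_lt_of_lt_one_right hρ (Real.tanh_lt_one _), fun x hx => ?_⟩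
  have hnorm := mem_sphere_zero_iff_norm.1 hx
  exact hτ x (hypRadius_of_norm_eq hρ hnorm) (mem_ball_of_norm_eq hρ hnorm)

theorem SolvesDirichletAtInfinity.pos {f : EuclideanSpace ℝ (Fin n) → ℝ} (hn : 2 ≤ n) (hρ : 0 < ρ)
    (hf : SolvesDirichletAtInfinity n ρ μ f) : 0 < μ := by
  by_contra! hμ
  obtain ⟨s, hs, hsρ, hsphere⟩ := hf.exists_sphere_lt hρ one_half_pos
  obtain ⟨⟨hsmooth, hequation⟩, horigin, -⟩ := hf
  have hsub : ∀ y ∈ Metric.ball 0 s, 1 / 2 < f y → 0 ≤ laplaceBeltrami (ballMetric n ρ) f y :=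
    fun y hy hfy => by
      have := hequation y (Metric.ball_subset_ball hsρ.le hy)
      have : μ * f y ≤ 0 := mul_nonpos_of_nonpos_of_nonneg hμ (by linarith)
      linarith
  have hle := le_of_forall_sphere_le hn hsρ hsmooth hsub (fun y hy => (hsphere y hy).le)
    (Metric.mem_closedBall_self hs)
  norm_num [horigin] at hle

end DirichletAtInfinity

end HypBall

theorem mainTheorem7 (k : ℕ) (hk : 1 ≤ k) (ρ : ℝ) (hρ : 0 < ρ) (μ : ℝ) :
    (∃ φ : ℝ → ℝ,
      HypBall.IsNormalizedRadialEigenfunction (k + 1) ρ μ φ ∧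
      (∀ ψ : ℝ → ℝ, HypBall.IsNormalizedRadialEigenfunction (k + 1) ρ μ ψ →
        Set.EqOn ψ φ (Set.Ici 0)) ∧
      (μ < 0 → Tendsto φ atTop atTop) ∧
      (μ = 0 → Tendsto φ atTop (𝓝 1)) ∧
      (0 < μ → Tendsto φ atTop (𝓝 0))) ∧
    ((∃ f : EuclideanSpace ℝ (Fin (k + 1)) → ℝ,
      HypBall.SolvesDirichletAtInfinity (k + 1) ρ μ f) ↔ 0 < μ) := by
  have hn : 1 < k + 1 := Nat.lt_add_of_pos_left hk
  have hφ := HypBall.isNormalizedRadialEigenfunction_radialEigenfunction (μ := μ) k.succ_pos hρ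
  refine ⟨⟨HypBall.radialEigenfunction (k + 1) ρ μ, hφ, fun ψ hψ => hψ.eqOn k.succ_pos hρ hφ,
    fun hμ => hφ.tendsto_atTop k.succ_pos hρ hμ, ?_, fun hμ => hφ.tendsto_zero hn hρ hμ⟩,
    fun ⟨f, hf⟩ => hf.pos hn hρ,
    fun hμ => ⟨_, hφ.solvesDirichletAtInfinity hρ (hφ.tendsto_zero hn hρ hμ)⟩⟩
  rintro rfl
  exact hφ.tendsto_one k.succ_pos hρ
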